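/- **Lemma ($L^1$ distance from Gaussian).** Let $g(x)=\frac{1}{\sqrt{2\pi}}e^{-x^2/2}$ be the standard Gaussian density on $\mathbb{R}$ and let $\gamma_k=\int_{\mathbb{R}} x^k g(x)\,dx$ be its $k$-th moment. There are absolute constants $c,c'>0$ such that the following holds for every integer $m\ge 2$ and every real $\epsilon>0$. Let $f:\mathbb{R}\to[0,\infty)$ be a logconcave probability density, that is, $\int f=1$ and $f(ax+by)\ge f(x)^{a}f(y)^{b}$ for all $x,y\in\mathbb{R}$ and $a,b\ge 0$ with $a+b=1$. Suppose that $f$ is isotropic, that is, $\int x f(x)\,dx=0$ and $\int x^2f(x)\,dx=1$, and that its first $m$ moments satisfy $$\left|\int_{\mathbb{R}} x^k f(x)\,dx-\gamma_k\right|<\epsilon\qquad (k=1,\dots,m).$$ Then $$\|f-g\|_{1}\;\le\;\left(\frac{c}{m^{1/8}}+c'\,m\,e^{m}\,\epsilon^2\right)^{1/2}\log m\;\le\; c\left(\frac{\log m}{m^{1/16}}+\epsilon\, m\, e^{m}\right).$$ -/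

import Mathlib

open MeasureTheory ProbabilityTheory

/-- `f : ℝ → ℝ` is a probability density with respect to Lebesgue measure. -/
def IsProbDensity (f : ℝ → ℝ) : Prop :=
  (∀ x, 0 ≤ f x) ∧ Integrable f ∧ ∫ x, f x = 1

/-- A function is logconcave if it is nonnegative and
`f (a x + b y) ≥ f x ^ a * f y ^ b` for all weights `a, b ≥ 0` with `a + b = 1`; the convention `0 ^ 0 = 1` makes the
endpoints `a = 0` and `b = 0` trivial. Equivalently, `f = exp h` for a concave `h` with values
in `[-∞, ∞)`. -/
def IsLogConcave (f : ℝ → ℝ) : Prop :=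
  (∀ x, 0 ≤ f x) ∧
    ∀ x y a b : ℝ, 0 ≤ a → 0 ≤ b → a + b = 1 → f x ^ a * f y ^ b ≤ f (a * x + b * y)

/-- The `k`-th moment of the distribution on `ℝ` with density `f`.
(For a logconcave probability density the integrand is integrable for every `k`.) -/
noncomputable def densityMoment (f : ℝ → ℝ) (k : ℕ) : ℝ :=
  ∫ x, x ^ k * f x

/-- A density is isotropic if it has mean zero and variance one.
(A nonzero second moment forces `x ^ 2 * f x`, hence also `x * f x`, to be integrable.) -/
def IsIsotropicDensity (f : ℝ → ℝ) : Prop :=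
  IsProbDensity f ∧ densityMoment f 1 = 0 ∧ densityMoment f 2 = 1

/-- The `k`-th moment of a standard Gaussian random variable. -/
noncomputable def gaussianMoment (k : ℕ) : ℝ :=
  ∫ x, x ^ k ∂(gaussianReal 0 1)

/-- The distance `‖f - g‖₁` in `L¹(ℝ)`, for integrable `f` and `g`. -/
noncomputable def l1Dist (f g : ℝ → ℝ) : ℝ :=
  ∫ x, |f x - g x|

/-!
The distance `‖f - g‖₁` is split by a Gaussian smoothing of standard deviation `1 / r`, where
`r = m ^ (1 / 16)`, applied to the difference `F = f - g`.

Smoothing moves `F` little. A logconcave density is unimodal, and an isotropic one is bounded by an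
absolute constant (`IsLogConcave.le_eleven`): if it were large at one point, logconcavity would make
it decay exponentially away from that point on a short scale, and the variance would be less than
one. A bounded unimodal function changes by `O(|z|)` in `L¹` under translation by `z`
(`integral_abs_sub_translate_le`), so the smoothing costs `O(1 / r)`
(`integral_abs_sub_smoothing_le`).

The smoothed difference is uniformly small. By Fourier inversion for the Gaussian kernel, it is an
average of the Fourier transform of `F` against a Gaussian of variance `r ^ 2`
(`abs_integral_gaussianPDFReal_mul_le`). At frequencies `|t| ≤ √j / 2`, with `j = ⌊m / 2⌋`, Taylor
expansion to the even order `2 j` bounds this transform by the moment differences plus a remainder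
governed by the Gaussian moment of order `2 j`
(`norm_integral_sub_gaussian_mul_cexp_le`). The remainder is at most `3 / 2 ^ j`, and the moment
differences contribute at most `ε exp (√j / 2)`. At higher frequencies the transform is at most `2`
and the Gaussian weight is `O(r ^ 2 / j)`.

The uniform bound is used on `[-r, r]`, and outside that interval the second moments of `f` and `g`
give `O(1 / r ^ 2)`. The total is `O(1 / r) + O(√m exp (m / 2) ε)`, which is what is claimed. When
`ε > 1` the trivial bound `‖f - g‖₁ ≤ 2` suffices. When `ε ≤ 1`, closeness of the moment of order
`2 j` to a Gaussian moment that is at least one forces that moment integral to converge, so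
finiteness of the moments of `f` need not be derived from logconcavity.
-/

/-! ### The Fourier transform of a density difference -/

/-- Taylor remainder of the exponential on the imaginary axis. There the remainder carries no factor
`exp ‖z‖`, so it can be integrated against a density that has only finitely many moments. -/
lemma norm_exp_sub_sum_le_of_re_eq_zero {z : ℂ} (hz : z.re = 0) (n : ℕ) :
    ‖Complex.exp z - ∑ k ∈ Finset.range n, z ^ k / (k.factorial : ℂ)‖
      ≤ ‖z‖ ^ n / n.factorial := by
  suffices h : ∀ n : ℕ, ∀ t ∈ Set.Icc (0 : ℝ) 1,
      ‖Complex.exp (t * z) - ∑ k ∈ Finset.range n, (t * z) ^ k / (k.factorial : ℂ)‖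
        ≤ ‖z‖ ^ n * t ^ n / n.factorial by
    simpa using h n 1 (by simp)
  intro n
  induction n with
  | zero =>
    intro t _
    have : (t * z).re = 0 := by simp [hz]
    simp [Complex.norm_exp, this]
  | succ n ih =>
    -- The derivative in `t` of the remainder of order `n + 1` is `z` times that of order `n`.
    have hder : ∀ t : ℝ, HasDerivAt (fun t : ℝ ↦ Complex.exp (t * z)
        - ∑ k ∈ Finset.range (n + 1), (t * z) ^ k / (k.factorial : ℂ))
        (z * (Complex.exp (t * z) - ∑ k ∈ Finset.range n, (t * z) ^ k / (k.factorial : ℂ))) t := by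
      intro t
      have h1 : HasDerivAt (fun t : ℝ ↦ (t : ℂ) * z) z t := by
        simpa using (Complex.ofRealCLM.hasDerivAt (x := t)).mul_const z
      have h2 : ∀ k : ℕ, HasDerivAt (fun t : ℝ ↦ ((t : ℂ) * z) ^ (k + 1) / ((k + 1).factorial : ℂ))
          (z * (((t : ℂ) * z) ^ k / (k.factorial : ℂ))) t := by
        intro k
        convert! (h1.pow (k + 1)).div_const ((k + 1).factorial : ℂ) using 1
        have : (k.factorial : ℂ) ≠ 0 := by exact_mod_cast k.factorial_ne_zero
        have h' : (k : ℂ) + 1 ≠ 0 := by exact_mod_cast k.succ_ne_zero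
        rw [Nat.factorial_succ]
        push_cast
        field_simp
      simp_rw [Finset.sum_range_succ' _ n]
      simp only [pow_zero, Nat.factorial_zero, Nat.cast_one, div_one]
      convert! h1.cexp.sub ((HasDerivAt.fun_sum fun k (_ : k ∈ Finset.range n) ↦ h2 k).add_const 1)
        using 1
      rw [← Finset.mul_sum]
      ring
    refine fun t ht ↦ image_norm_le_of_norm_deriv_right_le_deriv_boundary
      (B := fun t ↦ ‖z‖ ^ (n + 1) * t ^ (n + 1) / (n + 1).factorial)
      (B' := fun t ↦ ‖z‖ * (‖z‖ ^ n * t ^ n / n.factorial))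
      (fun t _ ↦ (hder t).continuousAt.continuousWithinAt)
      (fun t _ ↦ (hder t).hasDerivWithinAt) ?_ ?_ ?_ ht
    · simp [Finset.sum_range_succ']
    · intro t
      convert! (((hasDerivAt_id t).pow (n + 1)).const_mul (‖z‖ ^ (n + 1))).div_const
        ((n + 1).factorial : ℝ) using 1
      rw [Nat.factorial_succ]
      push_cast
      simp only [id]
      field_simp
      ring
    · intro t ht
      rw [norm_mul]
      exact mul_le_mul_of_nonneg_left (ih t ⟨ht.1, ht.2.le⟩) (norm_nonneg z)

/-- If the moments of `F` below order `n` are at most `ε`, its Fourier transform is small as long as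
the Taylor remainder of order `n` is. -/
lemma norm_integral_mul_cexp_le {F : ℝ → ℝ} {n : ℕ} {ε : ℝ} (hε : 0 ≤ ε)
    (hint : ∀ k ≤ n, Integrable fun x ↦ x ^ k * F x)
    (hmom : ∀ k < n, |∫ x, x ^ k * F x| ≤ ε) (t : ℝ) :
    ‖∫ x, (F x : ℂ) * Complex.exp (t * x * Complex.I)‖
      ≤ ε * Real.exp |t| + |t| ^ n / n.factorial * ∫ x, |x ^ n * F x| := by
  have hF : Integrable F := by simpa using hint 0 n.zero_le
  set P : ℝ → ℂ := fun x ↦ ∑ k ∈ Finset.range n, (t * x * Complex.I) ^ k / (k.factorial : ℂ)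
  have hterm : ∀ x (k : ℕ), (F x : ℂ) * ((t * x * Complex.I) ^ k / (k.factorial : ℂ))
      = ((t * Complex.I) ^ k / (k.factorial : ℂ)) * ((x ^ k * F x : ℝ) : ℂ) := by
    intro x k; push_cast; ring
  have hP : Integrable fun x ↦ (F x : ℂ) * P x := by
    simp_rw [P, Finset.mul_sum, hterm]
    exact integrable_finsetSum _ fun k hk ↦
      ((hint k (Finset.mem_range.1 hk).le).ofReal).const_mul _
  have hE : Integrable fun x ↦ (F x : ℂ) * Complex.exp (t * x * Complex.I) := by
    refine hF.ofReal.mul_bdd (c := 1) (by fun_prop) (ae_of_all _ fun x ↦ ?_)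
    rw [← Complex.ofReal_mul, Complex.norm_exp_ofReal_mul_I]
  have hsplit : ∫ x, (F x : ℂ) * Complex.exp (t * x * Complex.I)
      = (∫ x, (F x : ℂ) * P x)
        + ∫ x, (F x : ℂ) * (Complex.exp (t * x * Complex.I) - P x) := by
    simp_rw [mul_sub]
    rw [integral_sub hE hP]; ring
  have hmain : ‖∫ x, (F x : ℂ) * P x‖ ≤ ε * Real.exp |t| := by
    have : ∫ x, (F x : ℂ) * P x = ∑ k ∈ Finset.range n,
        ((t * Complex.I) ^ k / (k.factorial : ℂ)) * ((∫ x, x ^ k * F x : ℝ) : ℂ) := by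
      simp_rw [P, Finset.mul_sum, hterm]
      rw [integral_finsetSum _ fun k hk ↦
        ((hint k (Finset.mem_range.1 hk).le).ofReal).const_mul _]
      refine Finset.sum_congr rfl fun k _ ↦ ?_
      rw [integral_const_mul, integral_complex_ofReal]
    rw [this]
    calc _ ≤ ∑ k ∈ Finset.range n, |t| ^ k / k.factorial * ε := by
          refine norm_sum_le_of_le _ fun k hk ↦ ?_
          rw [norm_mul, norm_div, norm_pow, norm_mul, Complex.norm_I, mul_one, Complex.norm_real,
            Complex.norm_natCast, Complex.norm_real]
          exact mul_le_mul_of_nonneg_left (hmom k (Finset.mem_range.1 hk)) (by positivity)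
      _ ≤ _ := by
          rw [← Finset.sum_mul, mul_comm]
          exact mul_le_mul_of_nonneg_left (Real.sum_le_exp_of_nonneg (abs_nonneg t) n) hε
  have hrem : ‖∫ x, (F x : ℂ) * (Complex.exp (t * x * Complex.I) - P x)‖
      ≤ |t| ^ n / n.factorial * ∫ x, |x ^ n * F x| := by
    rw [← integral_const_mul]
    refine norm_integral_le_of_norm_le ((hint n le_rfl).abs.const_mul _) (ae_of_all _ fun x ↦ ?_)
    rw [norm_mul, Complex.norm_real, Real.norm_eq_abs]
    refine (mul_le_mul_of_nonneg_left
      (norm_exp_sub_sum_le_of_re_eq_zero (z := t * x * Complex.I) (by simp) n)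
      (abs_nonneg _)).trans_eq ?_
    simp only [norm_mul, Complex.norm_real, Real.norm_eq_abs, Complex.norm_I, mul_one, abs_mul,
      abs_pow, mul_pow]
    ring
  rw [hsplit]
  exact (norm_add_le _ _).trans (add_le_add hmain hrem)

/-! ### Gaussian moments -/

lemma gaussianMoment_eq_integral (k : ℕ) :
    gaussianMoment k = ∫ x, x ^ k * gaussianPDFReal 0 1 x := by
  simp [gaussianMoment, integral_gaussianReal_eq_integral_smul, mul_comm]

lemma integrable_pow_gaussianReal (v : NNReal) (k : ℕ) :
    Integrable (fun x ↦ x ^ k) (gaussianReal 0 v) := by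
  have := (memLp_id_gaussianReal (μ := 0) (v := v) k).integrable_norm_pow'
  refine (integrable_norm_iff (by fun_prop)).1 ?_
  simpa using this

lemma integral_sq_gaussianReal (v : NNReal) : ∫ x, x ^ 2 ∂(gaussianReal 0 v) = v := by
  have h := variance_fun_id_gaussianReal (μ := 0) (v := v)
  rw [variance_eq_integral (by fun_prop)] at h
  simpa using h

lemma integrable_mul_gaussianPDFReal_iff {h : ℝ → ℝ} {v : NNReal} (hv : v ≠ 0) :
    Integrable (fun x ↦ h x * gaussianPDFReal 0 v x) ↔ Integrable h (gaussianReal 0 v) := by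
  rw [gaussianReal_of_var_ne_zero _ hv,
    integrable_withDensity_iff (measurable_gaussianPDF _ _)
      (ae_of_all _ fun _ ↦ gaussianPDF_lt_top)]
  simp only [toReal_gaussianPDF]

lemma integrable_pow_mul_gaussianPDFReal (k : ℕ) :
    Integrable fun x ↦ x ^ k * gaussianPDFReal 0 1 x :=
  (integrable_mul_gaussianPDFReal_iff one_ne_zero).2 (integrable_pow_gaussianReal 1 k)

lemma one_le_gaussianMoment_two_mul (j : ℕ) : 1 ≤ gaussianMoment (2 * j) := by
  have h2 := integrable_pow_gaussianReal 1 2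
  have hlin : Integrable (fun x : ℝ ↦ 1 + (j : ℝ) * (x ^ 2 - 1)) (gaussianReal 0 1) :=
    (integrable_const _).add ((h2.sub (integrable_const _)).const_mul _)
  have hval : ∫ x, (1 + (j : ℝ) * (x ^ 2 - 1)) ∂(gaussianReal 0 1) = 1 := by
    have h3 : Integrable (fun x : ℝ ↦ x ^ 2 - 1) (gaussianReal 0 1) := h2.sub (integrable_const _)
    rw [integral_add (integrable_const _) (h3.const_mul _), integral_const_mul,
      integral_sub h2 (integrable_const _), integral_sq_gaussianReal]
    simp
  -- Bernoulli's inequality: `1 + j (x² - 1) ≤ (x²)ʲ`.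
  rw [← hval]
  refine integral_mono hlin (integrable_pow_gaussianReal 1 (2 * j)) fun x ↦ ?_
  have := one_add_mul_le_pow (a := x ^ 2 - 1) (by nlinarith [sq_nonneg x]) j
  simpa [pow_mul] using this

/-- Comparison with the moment generating function, via `y ^ (2 j) / (2 j)! ≤ cosh y`. -/
lemma gaussianMoment_two_mul_le (j : ℕ) (s : ℝ) :
    s ^ (2 * j) / (2 * j).factorial * gaussianMoment (2 * j) ≤ Real.exp (s ^ 2 / 2) := by
  have hexp : ∀ a : ℝ, ∫ x, Real.exp (a * x) ∂(gaussianReal 0 1) = Real.exp (a ^ 2 / 2) := by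
    intro a
    have := congrFun (mgf_fun_id_gaussianReal (μ := 0) (v := 1)) a
    simpa [mgf] using this
  have hi : ∀ a : ℝ, Integrable (fun x ↦ Real.exp (a * x)) (gaussianReal 0 1) :=
    integrable_exp_mul_gaussianReal
  have hcosh : ∫ x, (Real.exp (s * x) + Real.exp (-s * x)) / 2 ∂(gaussianReal 0 1)
      = Real.exp (s ^ 2 / 2) := by
    rw [integral_div, integral_add (hi s) (hi (-s)), hexp, hexp, neg_sq]; ring
  rw [gaussianMoment, ← integral_const_mul, ← hcosh]
  refine integral_mono ((integrable_pow_gaussianReal 1 _).const_mul _)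
    (((hi s).add (hi (-s))).div_const 2) fun x ↦ ?_
  have hs := Real.hasSum_cosh (s * x)
  have := hs.summable.le_tsum j fun i _ ↦ by rw [pow_mul]; positivity
  rw [hs.tsum_eq, Real.cosh_eq] at this
  simp only [neg_mul]
  convert! this using 1
  rw [mul_pow]; ring

/-! ### Gaussian smoothing -/

lemma gaussianPDFReal_zero_eq_integral_cexp {v : NNReal} (hv : v ≠ 0) (z : ℝ) :
    (gaussianPDFReal 0 v z : ℂ) = ((√(2 * Real.pi * v))⁻¹ : ℝ) *
      ∫ t, Complex.exp (t * z * Complex.I) ∂(gaussianReal 0 v⁻¹) := by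
  have h := charFun_gaussianReal (μ := 0) (v := v⁻¹) z
  rw [charFun_apply_real] at h
  have h' : ∫ t, Complex.exp (t * z * Complex.I) ∂(gaussianReal 0 v⁻¹)
      = Complex.exp (-((z ^ 2 / (2 * v) : ℝ) : ℂ)) := by
    simp_rw [mul_comm _ (z : ℂ)]
    rw [h]
    congr 1
    push_cast
    have : (v : ℂ) ≠ 0 := by exact_mod_cast hv
    field_simp
    simp [sq]
  rw [h', gaussianPDFReal]
  push_cast
  simp [neg_div]

/-- A frequency bound on `F` turned into a sup bound on its Gaussian smoothing. Frequencies beyond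
`S` are controlled by Chebyshev's inequality for the Gaussian weight of variance `v⁻¹`. -/
lemma abs_integral_gaussianPDFReal_mul_le {F : ℝ → ℝ} (hF : Integrable F) {v : NNReal}
    (hv : v ≠ 0) {B C S : ℝ} (hB : 0 ≤ B) (hC : 0 ≤ C) (hS : 0 < S)
    (hlow : ∀ t, |t| ≤ S → ‖∫ x, (F x : ℂ) * Complex.exp (t * x * Complex.I)‖ ≤ B)
    (hall : ∀ t : ℝ, ‖∫ x, (F x : ℂ) * Complex.exp (t * x * Complex.I)‖ ≤ C) (x : ℝ) :
    |∫ z, gaussianPDFReal 0 v z * F (x - z)|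
      ≤ (√(2 * Real.pi * v))⁻¹ * (B + C / S ^ 2 * (v : ℝ)⁻¹) := by
  have hsub : ∫ z, gaussianPDFReal 0 v z * F (x - z) = ∫ y, gaussianPDFReal 0 v (x - y) * F y := by
    rw [← integral_sub_left_eq_self (fun y ↦ gaussianPDFReal 0 v (x - y) * F y) volume x]
    simp
  have hprod : Integrable (Function.uncurry fun (y t : ℝ) ↦
      (F y : ℂ) * Complex.exp (t * (x - y : ℝ) * Complex.I))
      (volume.prod (gaussianReal 0 v⁻¹)) := by
    have h1 : Integrable (fun p : ℝ × ℝ ↦ (F p.1 : ℂ)) (volume.prod (gaussianReal 0 v⁻¹)) :=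
      Integrable.comp_fst (f := fun y ↦ (F y : ℂ)) hF.ofReal _
    refine h1.mul_bdd (c := 1) (by fun_prop) (ae_of_all _ fun p ↦ ?_)
    rw [← Complex.ofReal_mul, Complex.norm_exp_ofReal_mul_I]
  have hfub : ((∫ z, gaussianPDFReal 0 v z * F (x - z) : ℝ) : ℂ) = ((√(2 * Real.pi * v))⁻¹ : ℝ) *
      ∫ t, Complex.exp (t * x * Complex.I) *
        (∫ y, (F y : ℂ) * Complex.exp ((-t : ℝ) * y * Complex.I)) ∂(gaussianReal 0 v⁻¹) := by
    rw [hsub, ← integral_complex_ofReal]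
    have : ∀ y, ((gaussianPDFReal 0 v (x - y) * F y : ℝ) : ℂ) = ((√(2 * Real.pi * v))⁻¹ : ℝ) *
        ∫ t, (F y : ℂ) * Complex.exp (t * (x - y : ℝ) * Complex.I) ∂(gaussianReal 0 v⁻¹) := by
      intro y
      rw [integral_const_mul, Complex.ofReal_mul, gaussianPDFReal_zero_eq_integral_cexp hv]
      ring
    simp_rw [this]
    rw [integral_const_mul, integral_integral_swap hprod]
    congr 1
    refine integral_congr_ae (ae_of_all _ fun t ↦ ?_)
    simp only
    rw [← integral_const_mul]
    refine integral_congr_ae (ae_of_all _ fun y ↦ ?_)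
    simp only
    rw [mul_left_comm, ← Complex.exp_add]
    congr 2
    push_cast
    ring
  have hle : ‖∫ t, Complex.exp (t * x * Complex.I) *
        (∫ y, (F y : ℂ) * Complex.exp ((-t : ℝ) * y * Complex.I)) ∂(gaussianReal 0 v⁻¹)‖
      ≤ ∫ t, (B + C / S ^ 2 * t ^ 2) ∂(gaussianReal 0 v⁻¹) := by
    refine norm_integral_le_of_norm_le ((integrable_const _).add
      ((integrable_pow_gaussianReal _ 2).const_mul _)) (ae_of_all _ fun t ↦ ?_)
    rw [norm_mul, ← Complex.ofReal_mul, Complex.norm_exp_ofReal_mul_I, one_mul]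
    rcases le_or_gt |t| S with ht | ht
    · have := hlow (-t) (by rwa [abs_neg])
      have h2 : 0 ≤ C / S ^ 2 * t ^ 2 := by positivity
      linarith
    · refine (hall (-t)).trans ?_
      have h3 : S ^ 2 ≤ t ^ 2 := by rw [← sq_abs t]; gcongr
      have h4 : C * 1 ≤ C * (t ^ 2 / S ^ 2) :=
        mul_le_mul_of_nonneg_left ((one_le_div (by positivity)).2 h3) hC
      have h5 : C * (t ^ 2 / S ^ 2) = C / S ^ 2 * t ^ 2 := by ring
      linarith
  rw [integral_add (integrable_const _) ((integrable_pow_gaussianReal _ 2).const_mul _),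
    integral_const_mul, integral_sq_gaussianReal] at hle
  rw [← Real.norm_eq_abs, ← Complex.norm_real, hfub, norm_mul, Complex.norm_real,
    Real.norm_of_nonneg (by positivity)]
  refine mul_le_mul_of_nonneg_left (hle.trans_eq ?_) (by positivity)
  simp

lemma integrable_mul_sub_gaussianPDFReal {F : ℝ → ℝ} (hF : Integrable F) (v : NNReal) :
    Integrable (fun p : ℝ × ℝ ↦ gaussianPDFReal 0 v p.2 * F (p.1 - p.2))
      (volume.prod volume) := by
  simpa using (integrable_gaussianPDFReal 0 v).convolution_integrand
    (ContinuousLinearMap.mul ℝ ℝ) hF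

/-- The first absolute moment of a centred Gaussian is at most its standard deviation `σ`, because
`|z| ≤ (σ + z² / σ) / 2`. -/
lemma integral_abs_mul_gaussianPDFReal_le {v : NNReal} (hv : v ≠ 0) :
    ∫ z, |z| * gaussianPDFReal 0 v z ≤ √v := by
  have hs : 0 < √(v : ℝ) := Real.sqrt_pos.2 (by positivity)
  have h2 := integrable_pow_gaussianReal v 2
  have h1 : ∫ z, |z| * gaussianPDFReal 0 v z = ∫ z, |z| ∂(gaussianReal 0 v) := by
    simp [integral_gaussianReal_eq_integral_smul hv, mul_comm]
  have hv2 : ∫ z, (√(v : ℝ) / 2 + z ^ 2 * (1 / (2 * √v))) ∂(gaussianReal 0 v) = √v := by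
    rw [integral_add (integrable_const _) (h2.mul_const _), integral_mul_const,
      integral_sq_gaussianReal]
    simp only [integral_const, probReal_univ, smul_eq_mul, one_mul]
    have hsq : √(v : ℝ) ^ 2 = v := Real.sq_sqrt v.2
    field_simp
    linarith
  rw [h1, ← hv2]
  refine integral_mono (by simpa using (integrable_pow_gaussianReal v 1).abs)
    ((integrable_const _).add (h2.mul_const _)) fun z ↦ ?_
  have : √(v : ℝ) / 2 + z ^ 2 * (1 / (2 * √v)) - |z| = (√v - |z|) ^ 2 / (2 * √v) := by
    rw [← sq_abs z]; field_simp; ring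
  have h3 : 0 ≤ (√(v : ℝ) - |z|) ^ 2 / (2 * √v) := by positivity
  linarith

/-- A function whose translates move it by at most `K |z|` in `L¹` is within `K σ` in `L¹` of its
smoothing by a Gaussian of standard deviation `σ`. -/
lemma integral_abs_sub_smoothing_le {F : ℝ → ℝ} (hF : Integrable F) {v : NNReal} (hv : v ≠ 0)
    {K : ℝ} (hK : ∀ z, ∫ x, |F x - F (x - z)| ≤ K * |z|) :
    ∫ x, |F x - ∫ z, gaussianPDFReal 0 v z * F (x - z)| ≤ K * √v := by
  have hg := integrable_gaussianPDFReal 0 v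
  have h1 := integrable_mul_sub_gaussianPDFReal hF v
  have h0 : Integrable (fun p : ℝ × ℝ ↦ gaussianPDFReal 0 v p.2 * F p.1) (volume.prod volume) := by
    simpa [mul_comm] using hF.mul_prod hg
  have h2 : Integrable (fun p : ℝ × ℝ ↦ gaussianPDFReal 0 v p.2 * (F p.1 - F (p.1 - p.2)))
      (volume.prod volume) := by
    simpa [mul_sub] using! h0.sub h1
  have h3 : Integrable (fun p : ℝ × ℝ ↦ gaussianPDFReal 0 v p.2 * |F p.1 - F (p.1 - p.2)|)
      (volume.prod volume) := by
    simpa [abs_mul, abs_of_nonneg (gaussianPDFReal_nonneg 0 v _)] using h2.abs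
  have hpt : ∀ᵐ x, |F x - ∫ z, gaussianPDFReal 0 v z * F (x - z)|
      ≤ ∫ z, gaussianPDFReal 0 v z * |F x - F (x - z)| := by
    filter_upwards [h1.prod_right_ae] with x hx
    have : F x - ∫ z, gaussianPDFReal 0 v z * F (x - z)
        = ∫ z, gaussianPDFReal 0 v z * (F x - F (x - z)) := by
      simp_rw [mul_sub]
      rw [integral_sub (hg.mul_const _) hx, integral_mul_const,
        integral_gaussianPDFReal_eq_one 0 hv, one_mul]
    rw [this]
    refine (abs_integral_le_integral_abs).trans_eq ?_
    simp [abs_mul, abs_of_nonneg (gaussianPDFReal_nonneg 0 v _)]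
  calc _ ≤ ∫ x, ∫ z, gaussianPDFReal 0 v z * |F x - F (x - z)| :=
        integral_mono_ae ((hF.sub h1.integral_prod_left).abs) h3.integral_prod_left hpt
    _ = ∫ z, ∫ x, gaussianPDFReal 0 v z * |F x - F (x - z)| := integral_integral_swap h3
    _ ≤ ∫ z, K * (|z| * gaussianPDFReal 0 v z) := by
        refine integral_mono h3.integral_prod_right ?_ fun z ↦ ?_
        · refine ((integrable_mul_gaussianPDFReal_iff hv).2 ?_).const_mul _
          simpa using (integrable_pow_gaussianReal v 1).abs
        · simp only
          rw [integral_const_mul]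
          exact (mul_le_mul_of_nonneg_left (hK z) (gaussianPDFReal_nonneg 0 v z)).trans_eq (by ring)
    _ ≤ _ := by
        have hK0 : 0 ≤ K := by
          have := (integral_nonneg fun x ↦ abs_nonneg (F x - F (x - 1))).trans (hK 1)
          simpa using this
        rw [integral_const_mul]
        exact mul_le_mul_of_nonneg_left (integral_abs_mul_gaussianPDFReal_le hv) hK0

/-- Inside `[-R, R]` compare `F` with its smoothing, outside use the second moment. -/
lemma integral_abs_le_of_smoothing {F H : ℝ → ℝ} (hF : Integrable F) (hH : Integrable H)
    (hF2 : Integrable fun x ↦ x ^ 2 * |F x|) {R D : ℝ} (hR : 0 < R) (hD : ∀ x, |H x| ≤ D) :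
    ∫ x, |F x| ≤ (∫ x, |F x - H x|) + 2 * R * D + (∫ x, x ^ 2 * |F x|) / R ^ 2 := by
  have hi : Integrable ((Set.Icc (-R) R).indicator fun _ : ℝ ↦ D) :=
    (integrable_indicator_iff measurableSet_Icc).2 (integrableOn_const (by simp))
  have hval : ∫ x, (Set.Icc (-R) R).indicator (fun _ : ℝ ↦ D) x = 2 * R * D := by
    rw [integral_indicator_const _ measurableSet_Icc, Real.volume_real_Icc_of_le (by linarith)]
    simp only [smul_eq_mul]; ring
  have hd : Integrable fun x ↦ |F x - H x| := (hF.sub hH).abs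
  have hdi : Integrable fun x ↦ |F x - H x| + (Set.Icc (-R) R).indicator (fun _ : ℝ ↦ D) x :=
    hd.add hi
  rw [← hval, ← integral_add hd hi, ← integral_div, ← integral_add hdi (hF2.div_const _)]
  refine integral_mono hF.abs (hdi.add (hF2.div_const _)) fun x ↦ ?_
  have hnn : 0 ≤ x ^ 2 * |F x| / R ^ 2 := by positivity
  simp only [Set.indicator_apply]
  split_ifs with hx
  · have h1 : |F x| ≤ |F x - H x| + |H x| := by
      simpa using abs_add_le (F x - H x) (H x)
    have := hD x
    linarith
  · have hx' : R ≤ |x| := by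
      rw [Set.mem_Icc, ← abs_le] at hx
      exact (not_le.1 hx).le
    have h2 : R ^ 2 ≤ x ^ 2 := by rw [← sq_abs x]; gcongr
    have h3 : |F x| ≤ x ^ 2 * |F x| / R ^ 2 := by
      rw [le_div_iff₀ (by positivity), mul_comm]
      gcongr
    have := abs_nonneg (F x - H x)
    linarith

/-! ### Unimodal functions and logconcave densities -/

/-- A unimodal integrable function with `0 ≤ f ≤ M` moves by at most `2 M |z|` in `L¹` under a
translation by `z`. -/
lemma integral_abs_sub_translate_le {f : ℝ → ℝ} {M p : ℝ} (hf : Integrable f) (h0 : ∀ x, 0 ≤ f x)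
    (hM : ∀ x, f x ≤ M) (hmono : MonotoneOn f (Set.Iio p)) (hanti : AntitoneOn f (Set.Ioi p))
    (z : ℝ) : ∫ x, |f x - f (x - z)| ≤ 2 * M * |z| := by
  suffices h : ∀ s, 0 ≤ s → ∫ x, |f (x + s) - f x| ≤ 2 * M * s by
    rcases le_total 0 z with hz | hz
    · have := h z hz
      rw [← integral_sub_right_eq_self _ z] at this
      simpa [abs_of_nonneg hz] using this
    · have := h (-z) (by linarith)
      simp_rw [abs_sub_comm (f _) (f (_ - z))]
      simpa [abs_of_nonpos hz, sub_eq_add_neg] using this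
  intro s hs
  -- Off an interval of length `s`, the absolute increment of `f` equals the increment of the
  -- increasing part `u` minus that of the decreasing part `w`; both have integral zero.
  set u := (Set.Iio p).indicator f with hu
  set w := (Set.Ici p).indicator f with hw
  have hui : Integrable u := hf.indicator measurableSet_Iio
  have hwi : Integrable w := hf.indicator measurableSet_Ici
  have hi : Integrable ((Set.Icc (p - s) p).indicator fun _ : ℝ ↦ 2 * M) :=
    (integrable_indicator_iff measurableSet_Icc).2 (integrableOn_const (by simp))
  have hval : ∫ x, (Set.Icc (p - s) p).indicator (fun _ : ℝ ↦ 2 * M) x = 2 * M * s := by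
    rw [integral_indicator_const _ measurableSet_Icc, Real.volume_real_Icc_of_le (by linarith)]
    simp only [smul_eq_mul]; ring
  have hus : Integrable fun x ↦ u (x + s) - u x := (hui.comp_add_right s).sub hui
  have hws : Integrable fun x ↦ w x - w (x + s) := hwi.sub (hwi.comp_add_right s)
  have huw : Integrable fun x ↦ (u (x + s) - u x) + (w x - w (x + s)) := hus.add hws
  calc ∫ x, |f (x + s) - f x|
      ≤ ∫ x, ((u (x + s) - u x) + (w x - w (x + s))
          + (Set.Icc (p - s) p).indicator (fun _ : ℝ ↦ 2 * M) x) := by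
        refine integral_mono ((hf.comp_add_right s).sub hf).abs (huw.add hi) fun x ↦ ?_
        have hx0 := h0 x
        have hs0 := h0 (x + s)
        have hxM := hM x
        have hsM := hM (x + s)
        rcases lt_or_ge x (p - s) with h1 | h1
        · have h2 : x < p := by linarith
          have h3 : x + s < p := by linarith
          have := hmono h2 h3 (by linarith)
          simp [hu, hw, h2, h3, abs_of_nonneg (sub_nonneg.2 this)]
        rcases lt_or_ge p x with h2 | h2
        · have h3 : p < x + s := by linarith
          have := hanti h2 h3 (by linarith)
          simp [hu, hw, h2.le, h3.le, h2.not_ge, abs_of_nonpos (sub_nonpos.2 this),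
            Set.indicator]
        have h3 : p ≤ x + s := by linarith
        rcases h2.lt_or_eq with h4 | h4
        · simp only [hu, hw, Set.indicator, Set.mem_Iio, Set.mem_Ici, Set.mem_Icc, h1, h2, h3, h4,
            h3.not_gt, h4.not_ge, and_self, if_true, if_false]
          rw [abs_le]; constructor <;> linarith
        · simp only [hu, hw, Set.indicator, Set.mem_Iio, Set.mem_Ici, Set.mem_Icc, h1, h3, h4.ge,
            h3.not_gt, h4.ge.not_gt, h4.le, and_self, if_true, if_false]
          rw [abs_le]; constructor <;> linarith
    _ = 2 * M * s := by
        rw [integral_add huw hi, integral_add hus hws,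
          integral_sub (hui.comp_add_right s) hui, integral_sub hwi (hwi.comp_add_right s), hval,
          integral_add_right_eq_self, integral_add_right_eq_self]
        ring

lemma not_integrable_of_forall_le {f : ℝ → ℝ} {s : Set ℝ} (hs : MeasurableSet s)
    (hvol : volume s = ⊤) {a : ℝ} (ha : 0 < a) (h : ∀ x ∈ s, a ≤ f x) : ¬ Integrable f := by
  intro hf
  have h1 : IntegrableOn (fun _ : ℝ ↦ a) s :=
    hf.integrableOn.mono' (by fun_prop) ((ae_restrict_iff' hs).2 (ae_of_all _ fun x hx ↦ by
      rw [Real.norm_of_nonneg ha.le]; exact h x hx))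
  rw [integrableOn_const_iff] at h1
  simp [ha.ne', hvol] at h1

/-- A nonnegative integrable quasiconcave function with nonzero integral is unimodal. The value at
the mode `p` itself is left out, because the supremum need not be attained there. -/
lemma exists_unimodal {f : ℝ → ℝ} (h0 : ∀ x, 0 ≤ f x) (hint : Integrable f)
    (hne : ∫ x, f x ≠ 0)
    (hqc : ∀ x y z, x ≤ y → y ≤ z → min (f x) (f z) ≤ f y) :
    ∃ p, MonotoneOn f (Set.Iio p) ∧ AntitoneOn f (Set.Ioi p) := by
  obtain ⟨b, hb⟩ : ∃ b, 0 < f b := by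
    by_contra! h
    exact hne (by simp [fun x ↦ le_antisymm (h x) (h0 x)])
  set T : Set ℝ := {x | ∀ y, x ≤ y → f y ≤ f x} with hT
  -- Outside `T` a larger value lies further right, so `f` increases up to such a point.
  have hup : ∀ y, y ∉ T → ∀ w ≤ y, f w ≤ f y := by
    intro y hy w hw
    simp only [hT, Set.mem_ofPred_eq, not_forall, not_le] at hy
    obtain ⟨z, hyz, hz⟩ := hy
    exact (min_le_iff.1 (hqc w y z hw hyz)).resolve_right hz.not_ge
  have hdown : ∀ t ∈ T, ∀ x y, t ≤ x → x ≤ y → f y ≤ f x := fun t ht x y htx hxy ↦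
    (min_le_iff.1 (hqc t x y htx hxy)).elim (fun h ↦ (ht y (htx.trans hxy)).trans h) id
  have hTne : T.Nonempty := by
    by_contra! h
    refine not_integrable_of_forall_le (s := Set.Ici b) measurableSet_Ici (by simp) hb
      (fun x hx ↦ hup x (by simp [h]) b hx) hint
  have hTbdd : BddBelow T := by
    by_contra h
    refine not_integrable_of_forall_le (s := Set.Iic b) measurableSet_Iic (by simp) hb
      (fun x hx ↦ ?_) hint
    obtain ⟨t, ht, htx⟩ := not_bddBelow_iff.1 h x
    exact hdown t ht x b htx.le hx
  refine ⟨sInf T, fun x _ y hy hxy ↦ hup y (fun h ↦ ?_) x hxy, fun x hx y _ hxy ↦ ?_⟩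
  · exact (csInf_le hTbdd h).not_gt hy
  · obtain ⟨t, ht, htx⟩ := exists_lt_of_csInf_lt hTne hx
    exact hdown t ht x y htx.le hxy

lemma IsLogConcave.min_le {f : ℝ → ℝ} (hf : IsLogConcave f) {x y z : ℝ} (hxy : x ≤ y)
    (hyz : y ≤ z) : min (f x) (f z) ≤ f y := by
  rcases (hxy.trans hyz).eq_or_lt with h | h
  · obtain rfl : x = y := le_antisymm hxy (h ▸ hyz)
    exact min_le_left _ _
  have hzx : 0 < z - x := by linarith
  have hm : 0 ≤ min (f x) (f z) := le_min (hf.1 x) (hf.1 z)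
  set a := (z - y) / (z - x)
  set b := (y - x) / (z - x)
  have ha : 0 ≤ a := div_nonneg (by linarith) hzx.le
  have hb : 0 ≤ b := div_nonneg (by linarith) hzx.le
  have hab : a + b = 1 := by simp only [a, b]; field_simp; ring
  have hy : a * x + b * z = y := by simp only [a, b]; field_simp; ring
  calc min (f x) (f z) = min (f x) (f z) ^ a * min (f x) (f z) ^ b := by
        rw [← Real.rpow_add_of_nonneg hm ha hb, hab, Real.rpow_one]
    _ ≤ f x ^ a * f z ^ b := by
        gcongr
        · exact Real.rpow_nonneg (hf.1 x) _
        · exact min_le_left _ _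
        · exact min_le_right _ _
    _ ≤ f y := hy ▸ hf.2 x z a b ha hb hab

/-- A logconcave probability density with value `M` at `a` has dropped below `M / e` at distance
`3 / M` from `a`, as its mass would otherwise exceed `3 / e > 1`; from there on it decays
exponentially. -/
lemma IsLogConcave.le_mul_exp_neg {f : ℝ → ℝ} (hf : IsLogConcave f) (hd : IsProbDensity f)
    {a x : ℝ} (ha : 0 < f a) (hx : 3 / f a ≤ |x - a|) :
    f x ≤ f a * Real.exp (-(f a / 3 * |x - a|)) := by
  set M := f a with hMdef
  have hd0 : 0 < |x - a| := lt_of_lt_of_le (by positivity) hx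
  -- `q` is the point of the segment from `a` to `x` at distance `3 / M` from `a`.
  set b := 3 / M / |x - a| with hb
  have hb0 : 0 < b := by positivity
  have hb1 : b ≤ 1 := (div_le_one hd0).2 hx
  set q := (1 - b) * a + b * x with hq
  have hqa : |q - a| = 3 / M := by
    rw [show q - a = b * (x - a) by rw [hq]; ring, abs_mul, abs_of_pos hb0, hb]
    field_simp
  have hfq : f q ≤ M * Real.exp (-1) := by
    by_contra! hcon
    have hle : ∀ y ∈ Set.uIcc a q, M * Real.exp (-1) ≤ f y := by
      intro y hy
      have hmin : min (f a) (f q) ≤ f y := by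
        rcases Set.mem_uIcc.1 hy with h | h
        · exact hf.min_le h.1 h.2
        · rw [min_comm]; exact hf.min_le h.1 h.2
      refine le_trans (le_min ?_ hcon.le) hmin
      exact mul_le_of_le_one_right ha.le (Real.exp_le_one_iff.2 (by norm_num))
    have h1 : ∫ _ in Set.uIcc a q, M * Real.exp (-1) ≤ ∫ y, f y :=
      (setIntegral_mono_on (integrableOn_const (by simp [Set.uIcc])) hd.2.1.integrableOn
        measurableSet_uIcc hle).trans
        (setIntegral_le_integral hd.2.1 (ae_of_all _ hd.1))
    rw [hd.2.2, setIntegral_const, measureReal_def, Real.volume_interval,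
      ENNReal.toReal_ofReal (abs_nonneg _), hqa, smul_eq_mul, Real.exp_neg] at h1
    have h2 : 3 / M * (M * (Real.exp 1)⁻¹) = 3 / Real.exp 1 := by field_simp
    rw [h2, div_le_one (Real.exp_pos 1)] at h1
    linarith [Real.exp_one_lt_d9]
  have hlc := hf.2 a x (1 - b) b (by linarith) hb0.le (by ring)
  rw [← hq, ← hMdef] at hlc
  have hM1 : M = M ^ (1 - b) * M ^ b := by
    rw [← Real.rpow_add ha]; simp
  have h3 : f x ^ b ≤ (M * Real.exp (-(1 / b))) ^ b := by
    rw [Real.mul_rpow ha.le (Real.exp_pos _).le, ← Real.exp_mul,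
      show -(1 / b) * b = -1 by field_simp]
    refine le_of_mul_le_mul_left (a := M ^ (1 - b)) ?_ (Real.rpow_pos_of_pos ha _)
    rw [← mul_assoc, ← hM1]
    exact hlc.trans hfq
  have h4 := (Real.rpow_le_rpow_iff (hf.1 x) (by positivity) hb0).1 h3
  rwa [show 1 / b = M / 3 * |x - a| by rw [hb]; field_simp] at h4

lemma integral_sq_mul_exp_neg_mul_abs {c : ℝ} (hc : 0 < c) :
    ∫ x : ℝ, x ^ 2 * Real.exp (-(c * |x|)) = 4 / c ^ 3 := by
  have h1 := integral_comp_abs (f := fun x : ℝ ↦ x ^ 2 * Real.exp (-(c * x)))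
  have h2 := Real.integral_rpow_mul_exp_neg_mul_Ioi (a := 3) (r := c) (by norm_num) hc
  have h3 : Real.Gamma 3 = 2 := by
    rw [show (3 : ℝ) = (2 : ℕ) + 1 by norm_num, Real.Gamma_nat_eq_factorial]
    norm_num
  rw [h3] at h2
  simp only [sq_abs] at h1
  rw [h1]
  have h4 : ∫ x in Set.Ioi (0 : ℝ), x ^ 2 * Real.exp (-(c * x)) = (1 / c) ^ (3 : ℝ) * 2 := by
    rw [← h2]
    norm_num
  rw [h4]
  norm_num
  ring

lemma integrable_sq_mul_exp_neg_mul_abs {c : ℝ} (hc : 0 < c) :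
    Integrable fun x : ℝ ↦ x ^ 2 * Real.exp (-(c * |x|)) :=
  .of_integral_ne_zero (by rw [integral_sq_mul_exp_neg_mul_abs hc]; positivity)

lemma IsIsotropicDensity.integrable_sq_mul {f : ℝ → ℝ} (hf : IsIsotropicDensity f) :
    Integrable fun x ↦ x ^ 2 * f x :=
  .of_integral_ne_zero (hf.2.2.trans_ne one_ne_zero)

lemma IsIsotropicDensity.one_le_integral_sub_sq_mul {f : ℝ → ℝ} (hf : IsIsotropicDensity f)
    (a : ℝ) : (Integrable fun x ↦ (x - a) ^ 2 * f x) ∧ 1 ≤ ∫ x, (x - a) ^ 2 * f x := by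
  have h2 := hf.integrable_sq_mul
  obtain ⟨⟨h0, hi, hone⟩, hm1, hm2⟩ := hf
  have h1 : Integrable fun x ↦ x * f x := by
    refine (hi.add h2).mono' (by fun_prop) (ae_of_all _ fun x ↦ ?_)
    rw [norm_mul, Real.norm_eq_abs, Real.norm_of_nonneg (h0 x)]
    have : |x| ≤ 1 + x ^ 2 := by nlinarith [sq_abs x, sq_nonneg (|x| - 1)]
    have := mul_le_mul_of_nonneg_right this (h0 x)
    simp only [Pi.add_apply]
    linarith
  have he : (fun x ↦ (x - a) ^ 2 * f x)
      = fun x ↦ x ^ 2 * f x + (-2 * a) * (x * f x) + a ^ 2 * f x := by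
    ext x; ring
  have h12 : Integrable fun x ↦ x ^ 2 * f x + (-2 * a) * (x * f x) := h2.add (h1.const_mul _)
  rw [he]
  refine ⟨h12.add (hi.const_mul _), ?_⟩
  simp only [densityMoment, pow_one] at hm1 hm2
  rw [integral_add h12 (hi.const_mul _), integral_add h2 (h1.const_mul _), integral_const_mul,
    integral_const_mul, hm1, hm2, hone]
  nlinarith [sq_nonneg a]

/-- An isotropic logconcave density is bounded by an absolute constant: a high value forces
concentration, hence a small variance. -/
lemma IsLogConcave.le_eleven {f : ℝ → ℝ} (hf : IsLogConcave f) (hd : IsIsotropicDensity f)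
    (a : ℝ) : f a ≤ 11 := by
  by_contra! hcon
  have ha : 0 < f a := by linarith
  obtain ⟨hsi, hs1⟩ := hd.one_le_integral_sub_sq_mul a
  set M := f a with hM
  have hexp : Integrable fun x ↦ M * ((x - a) ^ 2 * Real.exp (-(M / 3 * |x - a|))) :=
    ((integrable_sq_mul_exp_neg_mul_abs (c := M / 3) (by positivity)).comp_sub_right a).const_mul M
  have hfi := hd.1.2.1
  have hle : ∫ x, (x - a) ^ 2 * f x
      ≤ ∫ x, ((3 / M) ^ 2 * f x + M * ((x - a) ^ 2 * Real.exp (-(M / 3 * |x - a|)))) := by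
    refine integral_mono hsi ((hfi.const_mul _).add hexp) fun x ↦ ?_
    have hfx := hf.1 x
    simp only
    rcases le_or_gt (3 / M) |x - a| with hx | hx
    · have h1 := mul_le_mul_of_nonneg_left (hf.le_mul_exp_neg hd.1 ha hx) (sq_nonneg (x - a))
      have h2 : 0 ≤ (3 / M) ^ 2 * f x := by positivity
      linarith
    · have h1 : (x - a) ^ 2 ≤ (3 / M) ^ 2 := by rw [← sq_abs (x - a)]; gcongr
      have h2 := mul_le_mul_of_nonneg_right h1 hfx
      have h3 : 0 ≤ M * ((x - a) ^ 2 * Real.exp (-(M / 3 * |x - a|))) := by positivity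
      linarith
  rw [integral_add (hfi.const_mul _) hexp, integral_const_mul, integral_const_mul, hd.1.2.2,
    integral_sub_right_eq_self (fun x ↦ x ^ 2 * Real.exp (-(M / 3 * |x|))) a,
    integral_sq_mul_exp_neg_mul_abs (by positivity)] at hle
  have h5 : (3 / M) ^ 2 * 1 + M * (4 / (M / 3) ^ 3) = 117 / M ^ 2 := by field_simp; norm_num
  rw [h5] at hle
  have h6 := hs1.trans hle
  rw [le_div_iff₀ (by positivity)] at h6
  nlinarith

lemma IsLogConcave.integral_abs_sub_translate_le {f : ℝ → ℝ} (hf : IsLogConcave f)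
    (hd : IsIsotropicDensity f) (z : ℝ) : ∫ x, |f x - f (x - z)| ≤ 22 * |z| := by
  obtain ⟨p, hp1, hp2⟩ := exists_unimodal hf.1 hd.1.2.1 (by rw [hd.1.2.2]; exact one_ne_zero)
    fun x y z hxy hyz ↦ hf.min_le hxy hyz
  refine (_root_.integral_abs_sub_translate_le hd.1.2.1 hf.1 (hf.le_eleven hd) hp1 hp2
    z).trans_eq ?_
  norm_num

lemma integral_abs_gaussianPDFReal_sub_translate_le (z : ℝ) :
    ∫ x, |gaussianPDFReal 0 1 x - gaussianPDFReal 0 1 (x - z)| ≤ 2 * |z| := by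
  have key : ∀ x y : ℝ, y ^ 2 ≤ x ^ 2 → gaussianPDFReal 0 1 x ≤ gaussianPDFReal 0 1 y := by
    intro x y h
    simp only [gaussianPDFReal, sub_zero]
    gcongr
  refine (integral_abs_sub_translate_le (M := 1) (p := 0) (integrable_gaussianPDFReal 0 1)
    (gaussianPDFReal_nonneg 0 1) (fun x ↦ ?_) (fun x hx y hy h ↦ ?_) (fun x hx y hy h ↦ ?_)
    z).trans_eq (by norm_num)
  · refine (key x 0 (by nlinarith)).trans ?_
    simp only [gaussianPDFReal, sub_zero, NNReal.coe_one, mul_one]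
    norm_num
    rw [← mul_inv, ← Real.sqrt_mul (by positivity)]
    refine inv_le_one_of_one_le₀ (Real.one_le_sqrt.2 ?_)
    nlinarith [Real.pi_gt_three]
  · simp only [Set.mem_Iio] at hx hy
    exact key x y (by nlinarith)
  · simp only [Set.mem_Ioi] at hx hy
    exact key y x (by nlinarith)

/-! ### Comparison with the Gaussian -/

lemma integrable_pow_mul_of_le {f : ℝ → ℝ} (hd : IsProbDensity f) {j k : ℕ} (hk : k ≤ 2 * j)
    (h : Integrable fun x ↦ x ^ (2 * j) * f x) : Integrable fun x ↦ x ^ k * f x := by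
  have hfi := hd.2.1
  refine (hfi.add h).mono' (by fun_prop) (ae_of_all _ fun x ↦ ?_)
  have hfx := hd.1 x
  have heven : x ^ (2 * j) = |x| ^ (2 * j) := ((even_two_mul j).pow_abs x).symm
  have hpow : |x| ^ k ≤ 1 + |x| ^ (2 * j) := by
    rcases le_total |x| 1 with hx | hx
    · exact (pow_le_one₀ (abs_nonneg x) hx).trans (by simp)
    · exact (pow_le_pow_right₀ hx hk).trans (by simp)
  rw [norm_mul, norm_pow, Real.norm_eq_abs, Real.norm_of_nonneg hfx]
  refine (mul_le_mul_of_nonneg_right hpow hfx).trans_eq ?_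
  simp only [Pi.add_apply, heven]
  ring

lemma isProbDensity_gaussianPDFReal : IsProbDensity (gaussianPDFReal 0 1) :=
  ⟨gaussianPDFReal_nonneg 0 1, integrable_gaussianPDFReal 0 1,
    integral_gaussianPDFReal_eq_one 0 one_ne_zero⟩

lemma abs_sub_le_add_of_nonneg {a b : ℝ} (ha : 0 ≤ a) (hb : 0 ≤ b) : |a - b| ≤ a + b :=
  abs_le.2 ⟨by linarith, by linarith⟩

lemma l1Dist_le_two {f g : ℝ → ℝ} (hf : IsProbDensity f) (hg : IsProbDensity g) :
    l1Dist f g ≤ 2 := by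
  calc l1Dist f g ≤ ∫ x, (f x + g x) :=
        integral_mono (hf.2.1.sub hg.2.1).abs (hf.2.1.add hg.2.1)
          fun x ↦ abs_sub_le_add_of_nonneg (hf.1 x) (hg.1 x)
    _ = 2 := by rw [integral_add hf.2.1 hg.2.1, hf.2.2, hg.2.2]; norm_num

/-- Closeness of moments up to the even order `2 j` makes the Fourier transforms close for
frequencies up to `√j / 2`, a constant fraction of the scale `√j` on which the Gaussian moment of
order `2 j` keeps the Taylor remainder bounded. -/
lemma norm_integral_sub_gaussian_mul_cexp_le {f : ℝ → ℝ} (hd : IsProbDensity f) {j : ℕ}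
    (hj : 1 ≤ j) {ε : ℝ} (hε0 : 0 ≤ ε) (hε1 : ε ≤ 1)
    (hmom : ∀ k : ℕ, 1 ≤ k → k ≤ 2 * j → |densityMoment f k - gaussianMoment k| < ε)
    {t : ℝ} (ht : |t| ≤ √j / 2) :
    ‖∫ x, ((f x - gaussianPDFReal 0 1 x : ℝ) : ℂ) * Complex.exp (t * x * Complex.I)‖
      ≤ ε * Real.exp (√j / 2) + 3 / 2 ^ j := by
  set g := gaussianPDFReal 0 1 with hg
  have hγ1 := one_le_gaussianMoment_two_mul j
  have hj' := abs_lt.1 (hmom (2 * j) (by omega) le_rfl)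
  have hpos : 0 < densityMoment f (2 * j) := by linarith [hj'.1]
  have hfn : Integrable fun x ↦ x ^ (2 * j) * f x := .of_integral_ne_zero hpos.ne'
  have hfk : ∀ k ≤ 2 * j, Integrable fun x ↦ x ^ k * f x := fun k hk ↦
    integrable_pow_mul_of_le hd hk hfn
  have hFk : ∀ k ≤ 2 * j, Integrable fun x ↦ x ^ k * (f x - g x) := fun k hk ↦ by
    simpa only [mul_sub] using! (hfk k hk).sub (integrable_pow_mul_gaussianPDFReal k)
  have hFm : ∀ k < 2 * j, |∫ x, x ^ k * (f x - g x)| ≤ ε := by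
    intro k hk
    have : ∫ x, x ^ k * (f x - g x) = densityMoment f k - gaussianMoment k := by
      simp_rw [mul_sub]
      rw [integral_sub (hfk k hk.le) (integrable_pow_mul_gaussianPDFReal k),
        gaussianMoment_eq_integral, densityMoment]
    rw [this]
    rcases k.eq_zero_or_pos with rfl | hk0
    · simpa [densityMoment, gaussianMoment, hd.2.2] using hε0
    · exact (hmom k hk0 hk.le).le
  have habs : ∫ x, |x ^ (2 * j) * (f x - g x)| ≤ 3 * gaussianMoment (2 * j) := by
    calc ∫ x, |x ^ (2 * j) * (f x - g x)|
        ≤ ∫ x, (x ^ (2 * j) * f x + x ^ (2 * j) * g x) := by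
          refine integral_mono (hFk _ le_rfl).abs
            (hfn.add (integrable_pow_mul_gaussianPDFReal _)) fun x ↦ ?_
          have he : 0 ≤ x ^ (2 * j) := (even_two_mul j).pow_nonneg x
          simp only
          rw [abs_mul, abs_of_nonneg he, ← mul_add]
          exact mul_le_mul_of_nonneg_left
            (abs_sub_le_add_of_nonneg (hd.1 x) (gaussianPDFReal_nonneg 0 1 x)) he
      _ = densityMoment f (2 * j) + gaussianMoment (2 * j) := by
          rw [integral_add hfn (integrable_pow_mul_gaussianPDFReal _),
            gaussianMoment_eq_integral, densityMoment]
      _ ≤ _ := by linarith [hj'.2]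
  refine (norm_integral_mul_cexp_le hε0 hFk hFm t).trans (add_le_add ?_ ?_)
  · gcongr
  -- The bound from the moment generating function at `s = √(2 j)` and the ratio
  -- `(t / s) ^ 2 ≤ 1 / 8` leave `(e / 8) ^ j ≤ 2 ^ (-j)`.
  have hbase : (√j / 2) ^ (2 * j) / (2 * j).factorial * gaussianMoment (2 * j) ≤ 1 / 2 ^ j := by
    have h1 := gaussianMoment_two_mul_le j √(2 * j)
    rw [Real.sq_sqrt (by positivity)] at h1
    have h2 : (√(j : ℝ) / 2) ^ (2 * j) = (1 / 8) ^ j * √(2 * j) ^ (2 * j) := by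
      rw [pow_mul, pow_mul, ← mul_pow, div_pow, Real.sq_sqrt (by positivity),
        Real.sq_sqrt (by positivity)]
      congr 1; ring
    have h3 : Real.exp (2 * j / 2) ≤ 4 ^ j := by
      rw [show (2 * (j : ℝ)) / 2 = j * 1 by ring, Real.exp_nat_mul]
      exact pow_le_pow_left₀ (Real.exp_pos _).le (by linarith [Real.exp_one_lt_d9]) j
    calc _ = (1 / 8) ^ j * (√(2 * j) ^ (2 * j) / (2 * j).factorial * gaussianMoment (2 * j)) := by
          rw [h2]; ring
      _ ≤ (1 / 8) ^ j * 4 ^ j := by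
          gcongr
          exact h1.trans h3
      _ = 1 / 2 ^ j := by
          rw [← mul_pow, ← one_div_pow]; norm_num
  calc |t| ^ (2 * j) / (2 * j).factorial * ∫ x, |x ^ (2 * j) * (f x - g x)|
      ≤ (√j / 2) ^ (2 * j) / (2 * j).factorial * (3 * gaussianMoment (2 * j)) := by
        gcongr
    _ = 3 * ((√j / 2) ^ (2 * j) / (2 * j).factorial * gaussianMoment (2 * j)) := by ring
    _ ≤ 3 * (1 / 2 ^ j) := by gcongr
    _ = 3 / 2 ^ j := by ring

/-- The `L¹` estimate with the smoothing scale `1 / r` and the truncation radius `r` still free. -/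
lemma l1Dist_gaussian_le {f : ℝ → ℝ} (hd : IsIsotropicDensity f) (hlc : IsLogConcave f) {j : ℕ}
    (hj : 1 ≤ j) {ε : ℝ} (hε0 : 0 ≤ ε) (hε1 : ε ≤ 1)
    (hmom : ∀ k : ℕ, 1 ≤ k → k ≤ 2 * j → |densityMoment f k - gaussianMoment k| < ε)
    {r : ℝ} (hr : 0 < r) :
    l1Dist f (gaussianPDFReal 0 1) ≤ 24 / r
      + 2 * r * (r * (ε * Real.exp (√j / 2) + 3 / 2 ^ j + 8 * r ^ 2 / j)) + 2 / r ^ 2 := by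
  set g := gaussianPDFReal 0 1 with hg
  have hgd := isProbDensity_gaussianPDFReal
  have hfi := hd.1.2.1
  have hgi := hgd.2.1
  have hf2 := hd.integrable_sq_mul
  have hg2 := integrable_pow_mul_gaussianPDFReal 2
  have hF : Integrable fun x ↦ f x - g x := hfi.sub hgi
  set v : NNReal := (r⁻¹ ^ 2).toNNReal with hv
  have hvr : (v : ℝ) = r⁻¹ ^ 2 := Real.coe_toNNReal _ (by positivity)
  have hv0 : v ≠ 0 := by
    rw [← NNReal.coe_ne_zero, hvr]; positivity
  have hK : ∀ z, ∫ x, |(f x - g x) - (f (x - z) - g (x - z))| ≤ 24 * |z| := by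
    intro z
    have h1 : Integrable fun x ↦ |f x - f (x - z)| := (hfi.sub (hfi.comp_sub_right z)).abs
    have h2 : Integrable fun x ↦ |g x - g (x - z)| := (hgi.sub (hgi.comp_sub_right z)).abs
    calc _ ≤ ∫ x, (|f x - f (x - z)| + |g x - g (x - z)|) := by
          refine integral_mono (hF.sub (hF.comp_sub_right z)).abs (h1.add h2) fun x ↦ ?_
          rw [show (f x - g x) - (f (x - z) - g (x - z))
            = (f x - f (x - z)) - (g x - g (x - z)) by ring]
          exact abs_sub _ _
      _ ≤ 24 * |z| := by
          rw [integral_add h1 h2]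
          linarith [hlc.integral_abs_sub_translate_le hd z,
            integral_abs_gaussianPDFReal_sub_translate_le z]
  have hsm := integral_abs_sub_smoothing_le hF hv0 hK
  have hj0 : (0 : ℝ) < j := by exact_mod_cast hj
  have hall : ∀ t : ℝ,
      ‖∫ x, ((f x - g x : ℝ) : ℂ) * Complex.exp (t * x * Complex.I)‖ ≤ 2 := by
    intro t
    refine (norm_integral_le_integral_norm _).trans ((l1Dist_le_two hd.1 hgd).trans_eq' ?_)
    refine integral_congr_ae (ae_of_all _ fun x ↦ ?_)
    simp only
    rw [norm_mul, ← Complex.ofReal_mul, Complex.norm_exp_ofReal_mul_I, Complex.norm_real, mul_one,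
      Real.norm_eq_abs]
  have hD : ∀ x, |∫ z, gaussianPDFReal 0 v z * (f (x - z) - g (x - z))|
      ≤ r * (ε * Real.exp (√j / 2) + 3 / 2 ^ j + 8 * r ^ 2 / j) := by
    intro x
    refine (abs_integral_gaussianPDFReal_mul_le hF hv0
      (B := ε * Real.exp (√j / 2) + 3 / 2 ^ j) (C := 2) (S := √j / 2) (by positivity)
      (by norm_num) (by positivity)
      (fun t ht ↦ norm_integral_sub_gaussian_mul_cexp_le hd.1 hj hε0 hε1 hmom ht) hall x).trans ?_
    have h1 : (√(2 * Real.pi * v))⁻¹ ≤ r := by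
      rw [inv_le_comm₀ (by positivity) hr]
      refine Real.le_sqrt_of_sq_le ?_
      rw [hvr]
      exact le_mul_of_one_le_left (by positivity) (by linarith [Real.pi_gt_three])
    have h2 : 2 / (√(j : ℝ) / 2) ^ 2 * (v : ℝ)⁻¹ = 8 * r ^ 2 / j := by
      rw [hvr, div_pow, Real.sq_sqrt hj0.le]
      field_simp
      norm_num
    rw [h2]
    gcongr
  have hF2 : Integrable fun x ↦ x ^ 2 * |f x - g x| := by
    have : Integrable fun x ↦ x ^ 2 * (f x - g x) := by
      simpa only [mul_sub] using! hf2.sub hg2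
    simpa [abs_mul] using this.abs
  have hF2le : ∫ x, x ^ 2 * |f x - g x| ≤ 2 := by
    calc _ ≤ ∫ x, (x ^ 2 * f x + x ^ 2 * g x) := by
          refine integral_mono hF2 (hf2.add hg2) fun x ↦ ?_
          simp only
          rw [← mul_add]
          exact mul_le_mul_of_nonneg_left
            (abs_sub_le_add_of_nonneg (hd.1.1 x) (hgd.1 x)) (sq_nonneg x)
      _ = 2 := by
          have h1 := hd.2.2
          have h2 := gaussianMoment_eq_integral 2
          rw [gaussianMoment, integral_sq_gaussianReal] at h2
          rw [densityMoment] at h1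
          rw [integral_add hf2 hg2, h1, ← h2]
          norm_num
  have hmain := integral_abs_le_of_smoothing hF
    (integrable_mul_sub_gaussianPDFReal hF v).integral_prod_left hF2 hr hD
  rw [hvr, Real.sqrt_sq (by positivity)] at hsm
  have h3 : (∫ x, x ^ 2 * |f x - g x|) / r ^ 2 ≤ 2 / r ^ 2 := by gcongr
  rw [l1Dist, div_eq_mul_inv 24 r]
  linarith

lemma exp_half_sq (x : ℝ) : Real.exp (x / 2) ^ 2 = Real.exp x := by
  rw [← Real.exp_nat_mul]; congr 1; push_cast; ring

/-- The estimate with the scale `r = m ^ (1 / 16)`. -/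
lemma l1Dist_gaussian_le_of_moments {f : ℝ → ℝ} (hd : IsIsotropicDensity f)
    (hlc : IsLogConcave f) {m : ℕ} (hm : 2 ≤ m) {ε : ℝ} (hε0 : 0 ≤ ε) (hε1 : ε ≤ 1)
    (hmom : ∀ k : ℕ, 1 ≤ k → k ≤ m → |densityMoment f k - gaussianMoment k| < ε) :
    l1Dist f (gaussianPDFReal 0 1)
      ≤ 92 / (m : ℝ) ^ (1 / 16 : ℝ) + 2 * √m * Real.exp (m / 2) * ε := by
  set r : ℝ := (m : ℝ) ^ (1 / 16 : ℝ) with hr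
  have hm1 : (1 : ℝ) ≤ m := by exact_mod_cast (by omega : 1 ≤ m)
  have hr1 : 1 ≤ r := Real.one_le_rpow hm1 (by norm_num)
  have hr0 : 0 < r := by linarith
  have hr16 : r ^ 16 = m := by
    rw [hr, ← Real.rpow_natCast, ← Real.rpow_mul (by positivity)]; norm_num
  set j := m / 2 with hjdef
  have hj : 1 ≤ j := by omega
  have hj0 : (0 : ℝ) < j := by exact_mod_cast hj
  have hj3 : (m : ℝ) ≤ 3 * j := by exact_mod_cast (by omega : m ≤ 3 * j)
  have h := l1Dist_gaussian_le hd hlc hj hε0 hε1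
    (fun k h1 h2 ↦ hmom k h1 (by omega)) hr0
  have hjinv : 1 / (j : ℝ) ≤ 3 / r ^ 16 := by
    rw [hr16, div_le_div_iff₀ hj0 (by linarith)]; linarith
  have hpow : 1 / (2 : ℝ) ^ j ≤ 1 / j := by
    gcongr
    exact_mod_cast Nat.lt_two_pow_self.le
  have hexp : Real.exp (√j / 2) ≤ Real.exp (m / 2) := by
    have h1 : √(j : ℝ) ≤ m := by
      refine Real.sqrt_le_iff.2 ⟨by positivity, ?_⟩
      have : (j : ℝ) ≤ m := by exact_mod_cast Nat.div_le_self m 2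
      nlinarith
    gcongr
  have hsq : r ^ 2 ≤ √m := by
    refine Real.le_sqrt_of_sq_le ?_
    rw [← hr16, ← pow_mul]
    exact pow_le_pow_right₀ hr1 (by norm_num)
  have t1 : 2 * r * (r * (ε * Real.exp (√j / 2))) ≤ 2 * √m * Real.exp (m / 2) * ε := by
    calc 2 * r * (r * (ε * Real.exp (√j / 2))) = 2 * r ^ 2 * Real.exp (√j / 2) * ε := by ring
      _ ≤ _ := by gcongr
  have hle : ∀ k : ℕ, k ≠ 0 → 1 / r ^ k ≤ 1 / r := fun k hk ↦
    one_div_le_one_div_of_le hr0 (le_self_pow₀ hr1 hk)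
  have t2 : 2 * r * (r * (3 / 2 ^ j)) ≤ 18 * (1 / r) := by
    calc 2 * r * (r * (3 / 2 ^ j)) = 6 * r ^ 2 * (1 / 2 ^ j) := by ring
      _ ≤ 6 * r ^ 2 * (3 / r ^ 16) :=
          mul_le_mul_of_nonneg_left (hpow.trans hjinv) (by positivity)
      _ = 18 * (1 / r ^ 14) := by field_simp; norm_num
      _ ≤ _ := by gcongr; exact le_self_pow₀ hr1 (by norm_num)
  have t3 : 2 * r * (r * (8 * r ^ 2 / j)) ≤ 48 * (1 / r) := by
    calc 2 * r * (r * (8 * r ^ 2 / j)) = 16 * r ^ 4 * (1 / j) := by ring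
      _ ≤ 16 * r ^ 4 * (3 / r ^ 16) := by gcongr
      _ = 48 * (1 / r ^ 12) := by field_simp; norm_num
      _ ≤ _ := by gcongr; exact le_self_pow₀ hr1 (by norm_num)
  have t4 := hle 2 (by norm_num)
  calc _ ≤ _ := h
    _ = 24 * (1 / r) + 2 * r * (r * (ε * Real.exp (√j / 2))) + 2 * r * (r * (3 / 2 ^ j))
        + 2 * r * (r * (8 * r ^ 2 / j)) + 2 * (1 / r ^ 2) := by ring
    _ ≤ 92 * (1 / r) + 2 * √m * Real.exp (m / 2) * ε := by linarith
    _ = _ := by ring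

theorem mainTheorem6 :
    ∃ c c' : ℝ, 0 < c ∧ 0 < c' ∧
      ∀ (m : ℕ) (ε : ℝ), 2 ≤ m → 0 < ε →
        ∀ f : ℝ → ℝ, IsIsotropicDensity f → IsLogConcave f →
          (∀ k : ℕ, 1 ≤ k → k ≤ m → |densityMoment f k - gaussianMoment k| < ε) →
            l1Dist f (gaussianPDFReal 0 1) ≤
                Real.sqrt (c / (m : ℝ) ^ (1 / 8 : ℝ) + c' * m * Real.exp m * ε ^ 2) *
                  Real.log m ∧
              Real.sqrt (c / (m : ℝ) ^ (1 / 8 : ℝ) + c' * m * Real.exp m * ε ^ 2) *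
                  Real.log m ≤
                c * (Real.log m / (m : ℝ) ^ (1 / 16 : ℝ) + ε * m * Real.exp m) := by
  -- `8 a² + 8 b² ≥ (2 (a + b))²` with `a = 92 / r`, `b = 2 √m e ^ (m / 2) ε` gives `8 * 92 ^ 2` and
  -- `32`; the factor `2` makes up for `log m ≥ 1 / 2`.
  refine ⟨67712, 32, by norm_num, by norm_num, fun m ε hm hε f hd hlc hmom ↦ ?_⟩
  have hm2 : (2 : ℝ) ≤ m := by exact_mod_cast hm
  have hlog : 1 / 2 ≤ Real.log m := by
    have := Real.log_le_log (by norm_num) hm2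
    linarith [Real.log_two_gt_d9]
  set r : ℝ := (m : ℝ) ^ (1 / 16 : ℝ) with hr
  have hr0 : 0 < r := by positivity
  have hr8 : (m : ℝ) ^ (1 / 8 : ℝ) = r ^ 2 := by
    rw [hr, ← Real.rpow_natCast, ← Real.rpow_mul (by positivity)]; norm_num
  set b : ℝ := √m * Real.exp (m / 2) * ε with hb
  have hb0 : 0 ≤ b := by positivity
  have hb2 : 32 * (m : ℝ) * Real.exp m * ε ^ 2 = 32 * b ^ 2 := by
    rw [hb, mul_pow, mul_pow, Real.sq_sqrt (by positivity), exp_half_sq]; ring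
  rw [hr8, hb2]
  constructor
  · have hkey : ∀ a, 0 ≤ a → l1Dist f (gaussianPDFReal 0 1) ≤ a →
        (2 * a) ^ 2 ≤ 67712 / r ^ 2 + 32 * b ^ 2 →
        l1Dist f (gaussianPDFReal 0 1) ≤ √(67712 / r ^ 2 + 32 * b ^ 2) * Real.log m := by
      intro a ha h1 h2
      have h3 := Real.le_sqrt_of_sq_le h2
      nlinarith
    rcases le_or_gt ε 1 with hε1 | hε1
    · refine hkey (92 / r + 2 * b) (by positivity) ?_ ?_
      · refine (l1Dist_gaussian_le_of_moments hd hlc hm hε.le hε1 hmom).trans_eq ?_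
        rw [hb]; ring
      · have : 67712 / r ^ 2 = 8 * (92 / r) ^ 2 := by field_simp; norm_num
        rw [this]
        nlinarith [sq_nonneg (92 / r - 2 * b)]
    · refine hkey 2 (by norm_num) (l1Dist_le_two hd.1 isProbDensity_gaussianPDFReal) ?_
      have h1 : 1 ≤ √(m : ℝ) := Real.one_le_sqrt.2 (by linarith)
      have h2 : 1 ≤ Real.exp (m / 2 : ℝ) := Real.one_le_exp (by positivity)
      have h3 : 1 ≤ b := one_le_mul_of_one_le_of_one_le (one_le_mul_of_one_le_of_one_le h1 h2) hε1.le
      have h4 : 0 ≤ 67712 / r ^ 2 := by positivity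
      nlinarith
  · have hlog0 : 0 ≤ Real.log m := by linarith
    have hlogm : Real.log m ≤ 2 * √m := by
      have h1 := Real.log_le_self (Real.sqrt_nonneg m)
      rw [Real.log_sqrt (by positivity)] at h1
      linarith
    have hsqrt : √(67712 / r ^ 2 + 32 * b ^ 2) ≤ 67712 / r + 6 * b := by
      refine Real.sqrt_le_iff.2 ⟨by positivity, ?_⟩
      have h1 : 67712 / r ^ 2 ≤ (67712 / r) ^ 2 := by rw [div_pow]; gcongr; norm_num
      have h2 : 0 ≤ 67712 / r * b := by positivity
      nlinarith [sq_nonneg b]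
    have hbm : b * Real.log m ≤ 2 * (ε * m * Real.exp m) := by
      have h1 : Real.exp (m / 2 : ℝ) ≤ Real.exp m := Real.exp_le_exp.2 (by linarith)
      calc b * Real.log m ≤ (√m * Real.exp m * ε) * (2 * √m) := by rw [hb]; gcongr
        _ = 2 * (ε * √m ^ 2 * Real.exp m) := by ring
        _ = _ := by rw [Real.sq_sqrt (by positivity)]
    have hE : 0 ≤ ε * m * Real.exp m := by positivity
    calc √(67712 / r ^ 2 + 32 * b ^ 2) * Real.log m
        ≤ (67712 / r + 6 * b) * Real.log m := by gcongr
      _ = 67712 * (Real.log m / r) + 6 * (b * Real.log m) := by ring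
      _ ≤ 67712 * (Real.log m / r + ε * m * Real.exp m) := by linarith
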